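/- By an \emph{arithmetic scheme} we mean a separated scheme of finite type over $\operatorname{Spec}\mathbb{Z}$. For an arithmetic scheme $X$ write $X_{\mathrm{red},\mathbb{C}} = X_{\mathrm{red}} \times_{\operatorname{Spec}\mathbb{Z}} \operatorname{Spec}\mathbb{C}$. Let $\mathcal{C}(\mathbb{Z})$ be the full subcategory of the category of arithmetic schemes generated by the following objects (that is, the smallest isomorphism-closed class of arithmetic schemes containing them and stable under the operations below): the empty scheme; $\operatorname{Spec}\mathbb{F}_q$ for each finite field $\mathbb{F}_q$; $\operatorname{Spec}\mathcal{O}_F$ for each abelian number field $F/\mathbb{Q}$; and all curves $C/\mathbb{F}_q$ over finite fields (integral one-dimensional schemes, separated and of finite type over $\mathbb{F}_q$); and the following operations: (0) an arithmetic scheme $X$ is in $\mathcal{C}(\mathbb{Z})$ if and only if $X_{\mathrm{red}}$ is in $\mathcal{C}(\mathbb{Z})$; (1) a finite disjoint union $\coprod_{1\le i\le r} X_i$ is in $\mathcal{C}(\mathbb{Z})$ if and only if each $X_i$ is in $\mathcal{C}(\mathbb{Z})$; (2) if $X$ is an arithmetic scheme, $Z \subseteq X$ a closed subscheme and $U = X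 \setminus Z$ the open complement, such that $Z_{\mathrm{red},\mathbb{C}}$, $X_{\mathrm{red},\mathbb{C}}$ and $U_{\mathrm{red},\mathbb{C}}$ are smooth and quasi-projective over $\mathbb{C}$, and if two of the three schemes $Z, X, U$ lie in $\mathcal{C}(\mathbb{Z})$, then so does the third; (3) if $X$ lies in $\mathcal{C}(\mathbb{Z})$, then so does the affine space $\mathbb{A}^r_X$ for each $r \ge 0$. \textbf{Proposition.} Let $B$ be a one-dimensional arithmetic scheme. Suppose that each generic point $\eta$ of (an irreducible component of) $B$ satisfies one of the following properties: (a) $\operatorname{char}\kappa(\eta) = p > 0$; (b) $\operatorname{char}\kappa(\eta) = 0$, and $\kappa(\eta)/\mathbb{Q}$ is an abelian number field. Then $B \in \mathcal{C}(\mathbb{Z})$. -/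

import Mathlib

open CategoryTheory CategoryTheory.Limits AlgebraicGeometry

noncomputable section

namespace ArithScheme

/-- An arithmetic scheme: separated and of finite type over `Spec ℤ`. -/
structure IsArithmeticScheme (X : Scheme.{0}) : Prop where
  isSeparated : IsSeparated (specZIsTerminal.from X)
  locallyOfFiniteType : LocallyOfFiniteType (specZIsTerminal.from X)
  quasiCompact : QuasiCompact (specZIsTerminal.from X)

/-- The reduced closed subscheme `X_red` of a scheme `X`. -/
def reduction (X : Scheme.{0}) : Scheme.{0} := X.nilradical.subscheme

/-- The base change `X_ℂ = X ×_{Spec ℤ} Spec ℂ`. -/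
def complexFiber (X : Scheme.{0}) : Scheme.{0} :=
  pullback (specZIsTerminal.from X) (Spec.map (CommRingCat.ofHom (Int.castRingHom ℂ)))

/-- The structure morphism `X_ℂ ⟶ Spec ℂ`. -/
def complexFiberToSpec (X : Scheme.{0}) : complexFiber X ⟶ Spec (CommRingCat.of ℂ) :=
  pullback.snd _ _

attribute [local instance] MvPolynomial.gradedAlgebra

/-- Projective space `ℙⁿ_K = Proj K[x₀, …, xₙ]`. -/
def projSpace (n : ℕ) (K : Type) [Field K] : Scheme.{0} :=
  Proj (MvPolynomial.homogeneousSubmodule (Fin (n + 1)) K)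

/-- The structure morphism `ℙⁿ_K ⟶ Spec K`, namely `Proj A ⟶ Spec A₀ ⟶ Spec K`. -/
def projSpaceToSpec (n : ℕ) (K : Type) [Field K] : projSpace n K ⟶ Spec (CommRingCat.of K) :=
  Proj.toSpecZero (MvPolynomial.homogeneousSubmodule (Fin (n + 1)) K) ≫
    Spec.map (CommRingCat.ofHom
      (algebraMap K (MvPolynomial.homogeneousSubmodule (Fin (n + 1)) K 0)))

/-- A scheme over a field `K` is quasi-projective if it admits an immersion over `K` into some
projective space `ℙⁿ_K`. -/
def IsQuasiProjective {K : Type} [Field K] {Y : Scheme.{0}} (f : Y ⟶ Spec (CommRingCat.of K)) :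
    Prop :=
  ∃ (n : ℕ) (g : Y ⟶ projSpace n K), IsImmersion g ∧ g ≫ projSpaceToSpec n K = f

/-- The condition that the complex variety `X_{red,ℂ}` is smooth and quasi-projective. -/
def HasSmoothQuasiProjectiveFiber (X : Scheme.{0}) : Prop :=
  Smooth (complexFiberToSpec (reduction X)) ∧ IsQuasiProjective (complexFiberToSpec (reduction X))

/-- A closed-open decomposition: `i : Z ⟶ X` is a closed immersion and `j : U ⟶ X` is an open
immersion onto the complement of `Z`. -/
structure IsClosedOpenDecomposition {Z X U : Scheme.{0}} (i : Z ⟶ X) (j : U ⟶ X) : Prop where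
  isClosedImmersion : IsClosedImmersion i
  isOpenImmersion : IsOpenImmersion j
  range_eq : Set.range j = (Set.range i)ᶜ

/-- A curve over a finite field `k`: an integral one-dimensional scheme, separated and of finite
type over `k`. -/
structure IsCurve {k : Type} [Field k] {C : Scheme.{0}} (f : C ⟶ Spec (CommRingCat.of k)) :
    Prop where
  isIntegral : IsIntegral C
  isSeparated : IsSeparated f
  locallyOfFiniteType : LocallyOfFiniteType f
  quasiCompact : QuasiCompact f
  dim_eq_one : topologicalKrullDim C = 1

/-- An abelian number field: a number field that is Galois over `ℚ` with abelian Galois group. -/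
def IsAbelianNumberField (F : Type) [Field F] : Prop :=
  ∃ _ : NumberField F, IsAbelianGalois ℚ F

/-- The class `𝒞(ℤ)` of arithmetic schemes: the smallest isomorphism-closed class of arithmetic
schemes containing the empty scheme, spectra of finite fields, spectra of rings of integers of
abelian number fields and curves over finite fields,
and stable under the operations listed below. -/
inductive ClassCZ : ObjectProperty Scheme.{0}
  | of_iso {X Y : Scheme.{0}} (e : X ≅ Y) : ClassCZ X → ClassCZ Y
  | empty : ClassCZ ∅
  | finiteField (k : Type) [Field k] [Finite k] : ClassCZ (Spec (CommRingCat.of k))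
  | ringOfIntegers (F : Type) [Field F] (hF : IsAbelianNumberField F) :
      ClassCZ (Spec (CommRingCat.of (NumberField.RingOfIntegers F)))
  | curve (k : Type) [Field k] [Finite k] {C : Scheme.{0}} (f : C ⟶ Spec (CommRingCat.of k))
      (hf : IsCurve f) : ClassCZ C
  /- an arithmetic scheme `X` is in the class if and only if `X_red` is -/
  | reduced {X : Scheme.{0}} : ClassCZ X → ClassCZ (reduction X)
  | of_reduced {X : Scheme.{0}} (hX : IsArithmeticScheme X) :
      ClassCZ (reduction X) → ClassCZ X
  /- a finite disjoint union is in the class if and only if each piece is -/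
  | coproduct {ι : Type} [Finite ι] (X : ι → Scheme.{0}) : (∀ i, ClassCZ (X i)) → ClassCZ (∐ X)
  | of_coproduct {ι : Type} [Finite ι] (X : ι → Scheme.{0}) (i : ι) : ClassCZ (∐ X) → ClassCZ (X i)
  /- two out of three for closed-open decompositions of an arithmetic scheme `X` such that
  `Z_{red,ℂ}`, `X_{red,ℂ}`, `U_{red,ℂ}` are smooth and quasi-projective -/
  | total {Z X U : Scheme.{0}} (i : Z ⟶ X) (j : U ⟶ X) (hX : IsArithmeticScheme X)
      (h : IsClosedOpenDecomposition i j) (sZ : HasSmoothQuasiProjectiveFiber Z)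
      (sX : HasSmoothQuasiProjectiveFiber X) (sU : HasSmoothQuasiProjectiveFiber U) :
      ClassCZ Z → ClassCZ U → ClassCZ X
  | openPart {Z X U : Scheme.{0}} (i : Z ⟶ X) (j : U ⟶ X) (hX : IsArithmeticScheme X)
      (h : IsClosedOpenDecomposition i j) (sZ : HasSmoothQuasiProjectiveFiber Z)
      (sX : HasSmoothQuasiProjectiveFiber X) (sU : HasSmoothQuasiProjectiveFiber U) :
      ClassCZ Z → ClassCZ X → ClassCZ U
  | closedPart {Z X U : Scheme.{0}} (i : Z ⟶ X) (j : U ⟶ X) (hX : IsArithmeticScheme X)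
      (h : IsClosedOpenDecomposition i j) (sZ : HasSmoothQuasiProjectiveFiber Z)
      (sX : HasSmoothQuasiProjectiveFiber X) (sU : HasSmoothQuasiProjectiveFiber U) :
      ClassCZ X → ClassCZ U → ClassCZ Z
  /- affine spaces over members of the class -/
  | affineSpace (r : ℕ) {X : Scheme.{0}} : ClassCZ X → ClassCZ (AffineSpace (Fin r) X)

end ArithScheme

end

/-!
The idea is to cut `B` into finitely many locally closed pieces, each of which is a generator of
the class or an open part of one, and to reassemble it with the two-out-of-three operation.

That operation asks for smooth quasi-projective complex fibers. The hypothesis on generic points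
propagates to all points: a point of characteristic zero that specializes from a point with
residue field algebraic over `ℚ` equals that point (`eq_of_specializes_of_isAlgebraic`), so every
residue field of `B` has positive characteristic or is an abelian number field
(`HasAdmissibleResidueFields.of_genericPoints`). This condition passes to all subschemes, and it
makes the rational fiber of a reduced scheme a finite discrete reduced `ℚ`-scheme, hence finite
étale. The complex fiber is then finite and smooth over `ℂ`, and finite schemes over a field embed
into projective space. So every subscheme that occurs satisfies the fiber condition
(`HasAdmissibleResidueFields.hasSmoothQuasiProjectiveFiber`).

By noetherian induction it remains to find, in each nonempty reduced scheme of the given kind, one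
nonempty open subscheme in the class (`ClassCZ.of_exists_open`). There is an integral affine open
`Spec A`. If `A` has characteristic `p > 0`, then `Spec A` is a curve over `𝔽_p` or the spectrum
of a finite field. If `A` has characteristic zero with fraction field `F`, then `A` and `𝓞 F`
become isomorphic after inverting a nonzero integer `m` (`exists_away_int_ringEquiv`), and
`Spec (𝓞 F)[1/m]` is the complement in `Spec (𝓞 F)` of a closed subscheme whose points all have
positive characteristic, which is covered by the first case.
-/

namespace ArithScheme

/-! ### Finite schemes over a field are quasi-projective -/

section Projective
attribute [local instance] MvPolynomial.gradedAlgebra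

open HomogeneousLocalization in
theorem val_mk_one_mul {A σ : Type} [CommRing A] [SetLike σ A] [AddSubgroupClass σ A] {𝒜 : ℕ → σ}
    [GradedRing 𝒜] {f : A} {m : ℕ} (hf : f ∈ 𝒜 m) {p : A} (hp : p ∈ 𝒜 (1 • m)) :
    algebraMap (Away 𝒜 f) (Localization.Away f) (Away.mk 𝒜 hf 1 p hp) *
      algebraMap A (Localization.Away f) f = algebraMap A _ p := by
  rw [HomogeneousLocalization.algebraMap_apply, Away.val_mk, Localization.mk_eq_mk', mul_comm]
  simp

open HomogeneousLocalization in
/-- A finite `K`-algebra `R` is a quotient of the coordinate ring of the chart `D₊(x₀)` of some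
projective space over `K`: with module generators `b₁, …, bₙ`, send `xᵢ / x₀` to `bᵢ`. -/
theorem exists_away_ringHom_surjective (K R : Type) [Field K] [CommRing R] [Algebra K R]
    [Module.Finite K R] :
    ∃ (n : ℕ) (ψ : Away (MvPolynomial.homogeneousSubmodule (Fin (n + 1)) K)
        (MvPolynomial.X 0) →+* R), Function.Surjective ψ ∧
      (ψ.comp (fromZeroRingHom _ _)).comp (algebraMap K
        (MvPolynomial.homogeneousSubmodule (Fin (n + 1)) K 0)) = algebraMap K R := by
  obtain ⟨n, b, hb⟩ := Module.Finite.exists_fin (R := K) (M := R)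
  let 𝒜 := MvPolynomial.homogeneousSubmodule (Fin (n + 1)) K
  let ev : MvPolynomial (Fin (n + 1)) K →ₐ[K] R := MvPolynomial.aeval (Fin.cons 1 b)
  have hev : IsUnit (ev (MvPolynomial.X 0)) := by simp [ev]
  let L : Localization.Away (MvPolynomial.X (R := K) (0 : Fin (n + 1))) →+* R :=
    IsLocalization.Away.lift (g := ev.toRingHom) (MvPolynomial.X 0) hev
  have hL (p : MvPolynomial (Fin (n + 1)) K) : L (algebraMap _ _ p) = ev p :=
    IsLocalization.Away.lift_eq _ _ _
  let ψ : Away 𝒜 (MvPolynomial.X 0) →+* R :=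
    L.comp (algebraMap (Away 𝒜 (MvPolynomial.X 0)) _)
  refine ⟨n, ψ, fun r ↦ ?_, ?_⟩
  · obtain ⟨c, hc⟩ := (Submodule.mem_span_range_iff_exists_fun K).mp
      (hb ▸ Submodule.mem_top : r ∈ _)
    let p : MvPolynomial (Fin (n + 1)) K := ∑ i, c i • MvPolynomial.X i.succ
    have hp : p ∈ 𝒜 1 := Submodule.sum_mem _ fun i _ ↦
      Submodule.smul_mem _ _ (MvPolynomial.isHomogeneous_X K _)
    -- The linear form `p = ∑ cᵢ xᵢ` makes `p / x₀` a preimage of `r = ∑ cᵢ bᵢ`.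
    refine ⟨Away.mk 𝒜 (MvPolynomial.isHomogeneous_X K 0) 1 p (by simpa using hp), ?_⟩
    have h : ψ (Away.mk 𝒜 (MvPolynomial.isHomogeneous_X K 0) 1 p (by simpa using hp)) *
        ev (MvPolynomial.X 0) = ev p := by
      rw [← hL, ← hL p]
      simp only [ψ, RingHom.comp_apply]
      rw [← map_mul]
      congr 1
      exact val_mk_one_mul _ _
    rw [← hc]
    simpa [ev, p] using h
  · ext x
    refine Eq.trans (?_ : _ = ev (MvPolynomial.C x)) (by simp [ev])
    rw [← hL]
    simp only [ψ, RingHom.comp_apply]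
    congr 1

open HomogeneousLocalization in
theorem exists_isImmersion_proj {A R σ : Type} [CommRing A] [CommRing R] [SetLike σ A]
    [AddSubgroupClass σ A] (𝒜 : ℕ → σ) [GradedRing 𝒜] {f : A} {m : ℕ} (hf : f ∈ 𝒜 m) (hm : 0 < m)
    (ψ : Away 𝒜 f →+* R) (hψ : Function.Surjective ψ) :
    ∃ g : Spec (.of R) ⟶ Proj 𝒜, IsImmersion g ∧ g ≫ Proj.toSpecZero 𝒜 =
      Spec.map (CommRingCat.ofHom (ψ.comp (fromZeroRingHom 𝒜 _))) := by
  have : IsClosedImmersion (Spec.map (CommRingCat.ofHom ψ)) :=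
    IsClosedImmersion.spec_of_surjective _ hψ
  refine ⟨Spec.map (CommRingCat.ofHom ψ) ≫ Proj.awayι 𝒜 f hf hm, inferInstance, ?_⟩
  rw [Category.assoc, Proj.awayι_toSpecZero, ← Spec.map_comp, ← CommRingCat.ofHom_comp]

theorem isQuasiProjective_of_isFinite {K : Type} [Field K] {Y : Scheme.{0}}
    (f : Y ⟶ Spec (CommRingCat.of K)) [IsFinite f] : IsQuasiProjective f := by
  have : IsAffine Y := isAffine_of_isAffineHom f
  obtain ⟨φ, hφ⟩ := Spec.map_surjective (Y.isoSpec.inv ≫ f)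
  have hfin : IsFinite (Spec.map φ) := hφ ▸ inferInstance
  rw [IsFinite.SpecMap_iff] at hfin
  algebraize [φ.hom]
  obtain ⟨n, ψ, hψ, hψ'⟩ := exists_away_ringHom_surjective K Γ(Y, ⊤)
  obtain ⟨g, hg, hg'⟩ := exists_isImmersion_proj _ (MvPolynomial.isHomogeneous_X K 0) one_pos ψ hψ
  refine ⟨n, Y.isoSpec.hom ≫ g, inferInstanceAs (IsImmersion (Y.isoSpec.hom ≫ g)), ?_⟩
  change (Y.isoSpec.hom ≫ g) ≫ Proj.toSpecZero _ ≫ Spec.map _ = f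
  rw [Category.assoc, reassoc_of% hg', ← Spec.map_comp, ← CommRingCat.ofHom_comp, hψ',
    ← Iso.eq_inv_comp, ← hφ]
  rfl

end Projective

/-! ### Points of characteristic zero and their residue fields -/

/-- The stalk maps of such a morphism are surjective and faithfully flat, hence isomorphisms. -/
theorem isReduced_of_flat_of_isPreimmersion {T Y : Scheme.{0}} (f : T ⟶ Y) [Flat f]
    [IsPreimmersion f] [IsReduced Y] : IsReduced T := by
  have (x : T) : _root_.IsReduced (T.presheaf.stalk x) := by
    have hflat := Flat.stalkMap f x
    have hsurj := f.stalkMap_surjective x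
    algebraize [(f.stalkMap x).hom]
    have : IsLocalHom (algebraMap (Y.presheaf.stalk (f x)) (T.presheaf.stalk x)) :=
      f.toLRSHom.prop x
    have : Module.FaithfullyFlat (Y.presheaf.stalk (f x)) (T.presheaf.stalk x) :=
      Module.FaithfullyFlat.of_flat_of_isLocalHom
    have hinj : Function.Injective (algebraMap (Y.presheaf.stalk (f x)) (T.presheaf.stalk x)) :=
      FaithfulSMul.algebraMap_injective _ _
    exact isReduced_of_injective (RingEquiv.ofBijective _ ⟨hinj, hsurj⟩).symm
      (RingEquiv.injective _)
  exact isReduced_of_isReduced_stalk T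

theorem topologicalKrullDim_le_zero_of_specializes {T : Scheme.{0}}
    (h : ∀ x y : T, x ⤳ y → x = y) : topologicalKrullDim T ≤ 0 := by
  refine Order.krullDim_nonpos_iff_forall_isMax.mpr fun Z W hZW ↦ ?_
  obtain ⟨x, hx⟩ := QuasiSober.sober Z.2 Z.3
  obtain ⟨y, hy⟩ := QuasiSober.sober W.2 W.3
  have hyx : y ⤳ x := hy.specializes (hZW hx.mem)
  obtain rfl := h _ _ hyx
  exact (SetLike.coe_injective (hy.symm.trans hx)).le

/-- Over a field, a quasi-compact scheme locally of finite type without nontrivial specializations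
is discrete, hence finite; over a perfect field it is also smooth if reduced, because its smooth
locus is dense. -/
theorem isFinite_and_smooth_of_discrete {K : Type} [Field K] [PerfectField K] {T : Scheme.{0}}
    (f : T ⟶ Spec (CommRingCat.of K)) [LocallyOfFiniteType f] [QuasiCompact f] [IsReduced T]
    (h : ∀ x y : T, x ⤳ y → x = y) : IsFinite f ∧ Smooth f := by
  have : IsLocallyNoetherian T := LocallyOfFiniteType.isLocallyNoetherian f
  have : IsLocallyArtinian T :=
    .of_topologicalKrullDim_le_zero (topologicalKrullDim_le_zero_of_specializes h)
  have : LocallyQuasiFinite f :=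
    locallyQuasiFinite_iff_isDiscrete_preimage_singleton.mpr fun x ↦
      ⟨inferInstance⟩
  refine ⟨.of_locallyQuasiFinite f, ?_⟩
  rw [← Scheme.Hom.smoothLocus_eq_top_iff]
  exact SetLike.coe_injective (dense_discrete.mp f.dense_smoothLocus_of_perfectField)

theorem residueFieldMap_bijective_of_isPreimmersion {X Y : Scheme.{0}} (f : X ⟶ Y)
    [IsPreimmersion f] (x : X) : Function.Bijective (f.residueFieldMap x) := by
  refine ⟨(f.residueFieldMap x).hom.injective, ?_⟩
  have := f.stalkMap_surjective x
  have h2 := (X.residue_surjective x).comp this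
  intro y
  obtain ⟨z, hz⟩ := h2 y
  refine ⟨Y.residue _ z, ?_⟩
  rw [← hz]
  exact congr($(Scheme.residue_residueFieldMap f x) z)


/-- If `f` vanishes at `x` but not at `η`, then `f` is a root at `η` of an integer polynomial with
nonzero constant term; that relation specializes to `x`, where it makes the constant term vanish. -/
theorem eq_of_specializes_of_isAlgebraic {X : Scheme.{0}} {η x : X} (h : η ⤳ x)
    [CharZero (X.residueField x)] [Algebra.IsAlgebraic ℤ (X.residueField η)] : η = x := by
  refine (h.antisymm ?_).eq
  obtain ⟨_, ⟨U, hU, rfl⟩, hxU, -⟩ :=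
    X.isBasis_affineOpens.exists_subset_of_mem_open (Set.mem_univ x) isOpen_univ
  have hηU : η ∈ U := h.mem_open U.isOpen hxU
  rw [specializes_iff_forall_open]
  intro V hV hηV
  obtain ⟨f, hf, hηf⟩ := hU.exists_basicOpen_le (V := ⟨V, hV⟩) ⟨η, hηV⟩ hηU
  refine hf (?_ : x ∈ X.basicOpen f)
  obtain ⟨p, hp0, hp⟩ := (Algebra.IsAlgebraic.isAlgebraic (R := ℤ)
    (X.evaluation U η hηU f)).exists_nonzero_coeff_and_aeval_eq_zero
      (mem_nonZeroDivisors_of_ne_zero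
        ((X.evaluation_ne_zero_iff_mem_basicOpen η hηU f).mpr hηf))
  have hev (y : X) (hy : y ∈ U) : X.evaluation U y hy (Polynomial.aeval f p) =
      Polynomial.aeval (X.evaluation U y hy f) p :=
    (Polynomial.aeval_algHom_apply (X.evaluation U y hy).hom.toIntAlgHom f p).symm
  have hxg : X.evaluation U x hxU (Polynomial.aeval f p) = 0 := by
    rw [Scheme.evaluation_eq_zero_iff_notMem_basicOpen]
    intro hx
    exact (X.evaluation_ne_zero_iff_mem_basicOpen η hηU _).mpr
      (h.mem_open (X.basicOpen _).isOpen hx) ((hev η hηU).trans hp)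
  rw [← Scheme.evaluation_ne_zero_iff_mem_basicOpen X x hxU]
  intro hfx
  rw [hev, hfx, ← Polynomial.coeff_zero_eq_aeval_zero'] at hxg
  exact hp0 (by simpa using hxg)

theorem isReduced_reduction (X : Scheme.{0}) : IsReduced (reduction X) := by
  have (i : _) : IsReduced (X.nilradical.subschemeCover.openCover.X i) := by
    change IsReduced (Spec (.of (Γ(X, i.1) ⧸ X.nilradical.ideal i)))
    have : _root_.IsReduced (Γ(X, i.1) ⧸ X.nilradical.ideal i) :=
      (Ideal.isRadical_iff_quotient_reduced _).mp (Ideal.radical_isRadical _)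
    rw [affine_isReduced_iff]
    exact this
  exact IsReduced.of_openCover _ X.nilradical.subschemeCover.openCover

theorem IsAbelianNumberField.of_ringEquiv {F F' : Type} [Field F] [Field F'] (e : F ≃+* F')
    (h : IsAbelianNumberField F) : IsAbelianNumberField F' := by
  obtain ⟨_, _⟩ := h
  have : CharZero F' := charZero_of_injective_ringHom (f := e.toRingHom) e.injective
  let e' : F ≃ₐ[ℚ] F' := AlgEquiv.ofRingEquiv (f := e) fun q ↦ by simp
  exact ⟨{ to_finiteDimensional := e'.toLinearEquiv.finiteDimensional },
    .of_algHom e'.symm.toAlgHom⟩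

/-! ### The complex fiber of a scheme with admissible residue fields -/

/-- Every residue field has positive characteristic or is an abelian number field. Unlike the
condition on generic points alone, this passes to arbitrary subschemes. -/
def HasAdmissibleResidueFields (X : Scheme.{0}) : Prop :=
  ∀ x : X, (∃ p : ℕ, 0 < p ∧ CharP (X.residueField x) p) ∨
    IsAbelianNumberField (X.residueField x)

theorem HasAdmissibleResidueFields.of_isPreimmersion {X Y : Scheme.{0}} (f : X ⟶ Y)
    [IsPreimmersion f] (h : HasAdmissibleResidueFields Y) : HasAdmissibleResidueFields X := by
  intro x
  let e := RingEquiv.ofBijective (f.residueFieldMap x).hom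
    (residueFieldMap_bijective_of_isPreimmersion f x)
  refine (h (f x)).imp (fun ⟨p, hp, _⟩ ↦ ⟨p, hp, ?_⟩) (IsAbelianNumberField.of_ringEquiv e)
  exact charP_of_injective_ringHom (f := e.toRingHom) e.injective p

theorem IsAbelianNumberField.isAlgebraic_int {F : Type} [Field F] (h : IsAbelianNumberField F) :
    Algebra.IsAlgebraic ℤ F := by
  obtain ⟨_, _⟩ := h
  exact (IsFractionRing.comap_isAlgebraic_iff (A := ℤ) (K := ℚ) (C := F)).mpr inferInstance

theorem IsArithmeticScheme.comp {X Y : Scheme.{0}} (f : X ⟶ Y) (h : IsArithmeticScheme Y)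
    [IsSeparated f] [LocallyOfFiniteType f] [QuasiCompact f] : IsArithmeticScheme X := by
  obtain ⟨_, _, _⟩ := h
  have e : specZIsTerminal.from X = f ≫ specZIsTerminal.from Y := specZIsTerminal.hom_ext _ _
  exact ⟨e ▸ inferInstance, e ▸ inferInstance, e ▸ inferInstance⟩

theorem IsArithmeticScheme.isNoetherian {X : Scheme.{0}} (h : IsArithmeticScheme X) :
    IsNoetherian X := by
  have := h.locallyOfFiniteType
  have := h.quasiCompact
  have : IsLocallyNoetherian X :=
    LocallyOfFiniteType.isLocallyNoetherian (specZIsTerminal.from X)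
  have : CompactSpace X := QuasiCompact.compactSpace_of_compactSpace (specZIsTerminal.from X)
  exact {}

theorem charZero_residueField {T : Scheme.{0}} (f : T ⟶ Spec (.of ℚ)) (x : T) :
    CharZero (T.residueField x) :=
  charZero_of_injective_ringHom (Spec.preimage (T.fromSpecResidueField x ≫ f)).hom.injective

/-- The inclusion of the generic point of `Spec ℤ`. -/
noncomputable abbrev specRatToSpecInt : Spec (.of ℚ) ⟶ Spec (.of ℤ) :=
  Spec.map (CommRingCat.ofHom (Int.castRingHom ℚ))

instance isPreimmersion_specRatToSpecInt : IsPreimmersion specRatToSpecInt :=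
  IsPreimmersion.of_isLocalization (R := ℤ) (S := ℚ) (nonZeroDivisors ℤ)

instance flat_specRatToSpecInt : Flat specRatToSpecInt := by
  have : Module.Flat ℤ ℚ := IsLocalization.flat ℚ (nonZeroDivisors ℤ)
  exact Flat.SpecMap_iff.mpr this

theorem isFinite_and_smooth_rationalFiber {Y : Scheme.{0}} [IsReduced Y]
    (hY : IsArithmeticScheme Y) (h : HasAdmissibleResidueFields Y) :
    IsFinite (pullback.snd (specZIsTerminal.from Y) specRatToSpecInt) ∧
      Smooth (pullback.snd (specZIsTerminal.from Y) specRatToSpecInt) := by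
  obtain ⟨_, _, _⟩ := hY
  let fst := pullback.fst (specZIsTerminal.from Y) specRatToSpecInt
  let snd := pullback.snd (specZIsTerminal.from Y) specRatToSpecInt
  have : IsReduced (pullback (specZIsTerminal.from Y) specRatToSpecInt) :=
    isReduced_of_flat_of_isPreimmersion fst
  refine isFinite_and_smooth_of_discrete snd fun x y hxy ↦ ?_
  have := charZero_residueField snd x
  have := charZero_residueField snd y
  have : Algebra.IsAlgebraic ℤ
      ((pullback (specZIsTerminal.from Y) specRatToSpecInt).residueField x) := by
    refine (h.of_isPreimmersion fst x).elim (fun ⟨p, hp, _⟩ ↦ ?_) (·.isAlgebraic_int)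
    exact absurd (CharP.eq _ ‹_› (CharP.ofCharZero _)) hp.ne'
  exact eq_of_specializes_of_isAlgebraic hxy

theorem isFinite_and_smooth_complexFiberToSpec {Y : Scheme.{0}} [IsReduced Y]
    (hY : IsArithmeticScheme Y) (h : HasAdmissibleResidueFields Y) :
    IsFinite (complexFiberToSpec Y) ∧ Smooth (complexFiberToSpec Y) := by
  obtain ⟨h₁, h₂⟩ := isFinite_and_smooth_rationalFiber hY h
  have e : Spec.map (CommRingCat.ofHom (Int.castRingHom ℂ)) =
      Spec.map (CommRingCat.ofHom (algebraMap ℚ ℂ)) ≫ specRatToSpecInt :=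
    specZIsTerminal.hom_ext _ _
  have s : IsPullback (pullback.fst _ _) (complexFiberToSpec Y) (specZIsTerminal.from Y)
      (Spec.map (CommRingCat.ofHom (algebraMap ℚ ℂ)) ≫ specRatToSpecInt) :=
    e ▸ IsPullback.of_hasPullback (specZIsTerminal.from Y) _
  have H := s.of_right' (IsPullback.of_hasPullback (specZIsTerminal.from Y) specRatToSpecInt)
  exact ⟨MorphismProperty.of_isPullback H h₁, MorphismProperty.of_isPullback H h₂⟩

theorem HasAdmissibleResidueFields.hasSmoothQuasiProjectiveFiber {X : Scheme.{0}}
    (hX : IsArithmeticScheme X) (h : HasAdmissibleResidueFields X) :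
    HasSmoothQuasiProjectiveFiber X := by
  have := isReduced_reduction X
  have := hX.isNoetherian
  let ι : reduction X ⟶ X := X.nilradical.subschemeι
  have : IsClosedImmersion ι := inferInstanceAs (IsClosedImmersion X.nilradical.subschemeι)
  obtain ⟨_, h₂⟩ := isFinite_and_smooth_complexFiberToSpec (hX.comp ι) (h.of_isPreimmersion ι)
  exact ⟨h₂, isQuasiProjective_of_isFinite _⟩

/-! ### Dévissage by open subschemes -/

/-- The condition on generic points propagates to all points, since points of characteristic zero
are generic. -/
theorem HasAdmissibleResidueFields.of_genericPoints {X : Scheme.{0}}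
    (h : ∀ η ∈ genericPoints X, (∃ p : ℕ, 0 < p ∧ CharP (X.residueField η) p) ∨
      IsAbelianNumberField (X.residueField η)) : HasAdmissibleResidueFields X := by
  intro x
  obtain ⟨p, hp⟩ := CharP.exists (X.residueField x)
  obtain hp0 | rfl := p.eq_zero_or_pos.symm
  · exact .inl ⟨p, hp0, hp⟩
  have : CharZero (X.residueField x) := CharP.charP_to_charZero _
  let η := genericPoints.ofComponent
    ⟨irreducibleComponent x, irreducibleComponent_mem_irreducibleComponents x⟩
  have hη : (η : X) ⤳ x :=
    (genericPoints.isGenericPoint_ofComponent _).specializes mem_irreducibleComponent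
  obtain ⟨p, hp, _⟩ | hF := h η η.2
  · have h₁ : x ∈ X.basicOpen (p : Γ(X, ⊤)) := by
      rw [← Scheme.evaluation_ne_zero_iff_mem_basicOpen X x (U := ⊤) trivial, map_natCast]
      exact_mod_cast hp.ne'
    have h₂ := hη.mem_open (X.basicOpen _).isOpen h₁
    rw [SetLike.mem_coe, ← Scheme.evaluation_ne_zero_iff_mem_basicOpen X _ (U := ⊤) trivial,
      map_natCast] at h₂
    exact absurd (CharP.cast_eq_zero _ p) h₂
  · have := hF.isAlgebraic_int
    exact .inr (eq_of_specializes_of_isAlgebraic hη ▸ hF)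

theorem ClassCZ.of_isEmpty (X : Scheme.{0}) [IsEmpty X] : ClassCZ X :=
  .of_iso (emptyIsInitial.uniqueUpToIso isInitialOfIsEmpty) .empty

/-- Noetherian induction: let `P` be a property of schemes that passes to closed subschemes and
guarantees admissible residue fields. If every nonempty reduced scheme with `P` has a nonempty open
subscheme in the class, then every scheme with `P` is in the class. -/
theorem ClassCZ.of_exists_open (P : Scheme.{0} → Prop)
    (hP : ∀ {Z X : Scheme.{0}} (i : Z ⟶ X) [IsClosedImmersion i], P X → P Z)
    (hA : ∀ X, P X → IsArithmeticScheme X ∧ HasAdmissibleResidueFields X)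
    (hU : ∀ X, P X → IsReduced X → Nonempty X →
      ∃ (U : Scheme.{0}) (j : U ⟶ X), IsOpenImmersion j ∧ Nonempty U ∧ ClassCZ U)
    (X : Scheme.{0}) (hX : P X) : ClassCZ X := by
  have := (hA X hX).1.isNoetherian
  suffices H : ∀ (T : TopologicalSpace.Closeds X) (Z : Scheme.{0}) (i : Z ⟶ X),
      IsClosedImmersion i → Set.range i = T → ClassCZ Z from
    H ⊤ X (𝟙 X) inferInstance (by simp)
  intro T
  induction T using WellFoundedLT.induction with | ind T ih => ?_
  intro Z i _ hT
  obtain hZ | hZ := isEmpty_or_nonempty Z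
  · exact .of_isEmpty Z
  let ρ : reduction Z ⟶ Z := Z.nilradical.subschemeι
  have : IsClosedImmersion ρ := inferInstanceAs (IsClosedImmersion Z.nilradical.subschemeι)
  have hρ : Set.range ρ = Set.univ := by
    exact (Scheme.IdealSheafData.range_subschemeι _).trans (by simp)
  have hY : P (reduction Z) := hP (ρ ≫ i) hX
  -- The open subscheme is only provided for reduced schemes, so `Z` is replaced by `Z_red`.
  refine .of_reduced (hA Z (hP i hX)).1 ?_
  have : Nonempty (reduction Z) := by
    obtain ⟨z⟩ := hZ
    obtain ⟨y, -⟩ := hρ ▸ Set.mem_univ z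
    exact ⟨y⟩
  obtain ⟨U, j, _, ⟨u⟩, hU⟩ := hU _ hY (isReduced_reduction Z) this
  let C : TopologicalSpace.Closeds (reduction Z) :=
    ⟨(Set.range j)ᶜ, j.isOpenEmbedding.isOpen_range.isClosed_compl⟩
  let I := Scheme.IdealSheafData.vanishingIdeal C
  have hI : Set.range I.subschemeι = (Set.range j)ᶜ := by
    rw [Scheme.IdealSheafData.range_subschemeι, Scheme.IdealSheafData.coe_support_vanishingIdeal]
    rfl
  have hYA := hA _ hY
  have := hYA.1.isNoetherian
  have good {V} (f : V ⟶ reduction Z) [IsPreimmersion f] [LocallyOfFiniteType f] [QuasiCompact f] :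
      HasSmoothQuasiProjectiveFiber V :=
    (hYA.2.of_isPreimmersion f).hasSmoothQuasiProjectiveFiber (hYA.1.comp f)
  have hdec : IsClosedOpenDecomposition I.subschemeι j :=
    ⟨inferInstance, inferInstance, by rw [hI, compl_compl]⟩
  refine ClassCZ.total I.subschemeι j hYA.1 hdec (good I.subschemeι) (good (𝟙 _)) (good j) ?_ hU
  -- The complement misses the image of `u`, so its image in `X` is strictly smaller than `T`.
  refine ih ⟨Set.range (I.subschemeι ≫ ρ ≫ i),
    (I.subschemeι ≫ ρ ≫ i).isClosedEmbedding.isClosed_range⟩ ?_ _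
    (I.subschemeι ≫ ρ ≫ i) inferInstance rfl
  rw [← SetLike.coe_ssubset_coe]
  change Set.range _ ⊂ _
  rw [← hT, Set.ssubset_iff_of_subset]
  · refine ⟨i (ρ (j u)), ⟨_, rfl⟩, ?_⟩
    rintro ⟨w, hw⟩
    have := (ρ ≫ i).isClosedEmbedding.injective (a₁ := I.subschemeι w) (a₂ := j u)
      (by simpa using hw)
    exact (hI ▸ ⟨w, rfl⟩ : I.subschemeι w ∈ (Set.range j)ᶜ) ⟨u, this.symm⟩
  · rintro _ ⟨w, rfl⟩
    exact ⟨ρ (I.subschemeι w), by simp⟩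

theorem isArithmeticScheme_Spec_iff {A : CommRingCat.{0}} :
    IsArithmeticScheme (Spec A) ↔ Algebra.FiniteType ℤ A := by
  have e : specZIsTerminal.from (Spec A) =
    Spec.map (CommRingCat.ofHom (algebraMap ℤ A)) := specZIsTerminal.hom_ext _ _
  have H : LocallyOfFiniteType (specZIsTerminal.from (Spec A)) ↔ Algebra.FiniteType ℤ A := by
    rw [e, HasRingHomProperty.Spec_iff (P := @LocallyOfFiniteType)]
    exact RingHom.finiteType_algebraMap
  exact ⟨fun h ↦ H.mp h.2, fun h ↦ ⟨e ▸ inferInstance, H.mpr h, e ▸ inferInstance⟩⟩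

theorem exists_isOpenImmersion_Spec_isDomain (X : Scheme.{0}) [IsNoetherian X] [IsReduced X]
    [Nonempty X] : ∃ (A : CommRingCat.{0}) (j : Spec A ⟶ X), IsOpenImmersion j ∧ IsDomain A := by
  obtain ⟨x⟩ := ‹Nonempty X›
  obtain ⟨o, ho, ⟨y, hy⟩, hoZ⟩ :=
    TopologicalSpace.NoetherianSpace.exists_isOpen_nonempty_subset_irreducibleComponent _
      (irreducibleComponent_mem_irreducibleComponents x)
  obtain ⟨V, hV, hyV, hVo⟩ := exists_isAffineOpen_mem_and_subset (U := ⟨o, ho⟩) hy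
  have : IrreducibleSpace V := isIrreducible_iff_irreducibleSpace.mp
    ⟨⟨y, hyV⟩, isIrreducible_irreducibleComponent.isPreirreducible.open_subset V.isOpen
      (hVo.trans hoZ)⟩
  have : IsIntegral V := isIntegral_of_irreducibleSpace_of_isReduced _
  have : Nonempty (Spec Γ(X, V)) := ⟨hV.isoSpec.hom ⟨y, hyV⟩⟩
  exact ⟨_, hV.fromSpec, inferInstance,
    (affine_isIntegral_iff _).mp (isIntegral_of_isOpenImmersion hV.isoSpec.inv)⟩

/-! ### Integral models of a number field agree away from an integer -/

theorem exists_int_smul_mem_range {A F : Type} [CommRing A] [IsDomain A] [Field F] [CharZero F]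
    [Algebra A F] [IsFractionRing A F] [Algebra.IsAlgebraic ℤ F] (x : F) :
    ∃ m : ℤ, m ≠ 0 ∧ (m : F) * x ∈ (algebraMap A F).range := by
  obtain ⟨a, b, hb, rfl⟩ := IsFractionRing.div_surjective (A := A) x
  have hb0 : algebraMap A F b ≠ 0 := (map_ne_zero_iff _ (IsFractionRing.injective A F)).mpr
    (nonZeroDivisors.ne_zero hb)
  have : Algebra.IsAlgebraic ℤ A := .of_injective (algebraMap A F).toIntAlgHom
    (IsFractionRing.injective A F)
  obtain ⟨m, hm, c, hc⟩ := (Algebra.IsAlgebraic.isAlgebraic (R := ℤ) b).exists_nonzero_dvd hb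
  refine ⟨m, hm, c * a, ?_⟩
  have : (m : F) = algebraMap A F b * algebraMap A F c := by
    rw [← map_mul, ← hc]; simp
  rw [this, map_mul]
  field_simp

/-- Finitely many generators of `B` have a common integer denominator `m` with respect to `A`, so
`f` maps `B` into the subring `A[1/m]` of `F`. -/
theorem exists_int_pow_smul_mem_range {A B F : Type} [CommRing A] [IsDomain A] [CommRing B]
    [Algebra.FiniteType ℤ B] [Field F] [CharZero F]
    [Algebra A F] [IsFractionRing A F] [Algebra.IsAlgebraic ℤ F] (f : B →+* F) :
    ∃ m : ℤ, m ≠ 0 ∧ ∀ b, ∃ k : ℕ, (m : F) ^ k * f b ∈ (algebraMap A F).range := by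
  obtain ⟨s, hs⟩ := Algebra.FiniteType.out (R := ℤ) (A := B)
  choose m hm hmem using fun x : F ↦ exists_int_smul_mem_range (A := A) x
  let N := ∏ b ∈ s, m (f b)
  have hN (k : ℕ) : (N : F) ^ k ∈ (algebraMap A F).range := ⟨(N : A) ^ k, by simp⟩
  refine ⟨N, Finset.prod_ne_zero_iff.mpr fun b _ ↦ hm _, fun b ↦ ?_⟩
  induction (hs ▸ Algebra.mem_top : b ∈ Algebra.adjoin ℤ (s : Set B)) using
    Algebra.adjoin_induction with
  | mem b hb =>
    obtain ⟨c, hc⟩ := Finset.dvd_prod_of_mem (fun b ↦ m (f b)) hb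
    refine ⟨1, ?_⟩
    have : (N : F) ^ 1 * f b = ((c : A) : A) • ((m (f b) : F) * f b) := by
      rw [pow_one, show N = _ from hc, Algebra.smul_def]; push_cast; simp; ring
    rw [this, Algebra.smul_def]
    exact mul_mem ⟨_, rfl⟩ (hmem _)
  | algebraMap r => exact ⟨0, r, by simp⟩
  | add x y _ _ hx hy =>
    obtain ⟨⟨k, hk⟩, l, hl⟩ := And.intro hx hy
    refine ⟨k + l, ?_⟩
    have : (N : F) ^ (k + l) * f (x + y) =
        N ^ l * (N ^ k * f x) + N ^ k * (N ^ l * f y) := by rw [map_add]; ring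
    exact this ▸ add_mem (mul_mem (hN _) hk) (mul_mem (hN _) hl)
  | mul x y _ _ hx hy =>
    obtain ⟨⟨k, hk⟩, l, hl⟩ := And.intro hx hy
    refine ⟨k + l, ?_⟩
    have : (N : F) ^ (k + l) * f (x * y) = (N ^ k * f x) * (N ^ l * f y) := by rw [map_mul]; ring
    exact this ▸ mul_mem hk hl

/-- The localization `A[1/m]`, realized as the subring of `F` of elements that some power of `m`
multiplies into `A`. -/
theorem exists_away_ringHom_range {A F : Type} [CommRing A] [Field F] [CharZero F]
    [Algebra A F] (hA : Function.Injective (algebraMap A F)) {m : ℤ} (hm : m ≠ 0) :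
    ∃ g : Localization.Away (m : A) →+* F, Function.Injective g ∧
      ∀ x, x ∈ g.range ↔ ∃ k : ℕ, (m : F) ^ k * x ∈ (algebraMap A F).range := by
  have hm' : (m : F) ≠ 0 := Int.cast_ne_zero.mpr hm
  have hu : IsUnit (algebraMap A F (m : A)) := by simpa using hm
  let g : Localization.Away (m : A) →+* F := IsLocalization.Away.lift (m : A) hu
  have hg (a : A) : g (algebraMap _ _ a) = algebraMap A F a := IsLocalization.Away.lift_eq _ _ _
  have key (z) : ∃ (k : ℕ) (a : A), (m : F) ^ k * g z = algebraMap A F a ∧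
      (m : Localization.Away (m : A)) ^ k * z = algebraMap _ _ a := by
    obtain ⟨k, a, h⟩ := IsLocalization.Away.surj (m : A) z
    have h' : (m : Localization.Away (m : A)) ^ k * z = algebraMap _ _ a := by
      rw [mul_comm]; simpa using h
    exact ⟨k, a, by rw [← hg, ← h']; simp, h'⟩
  have hum : IsUnit (m : Localization.Away (m : A)) := by
    simpa using IsLocalization.Away.algebraMap_isUnit (S := Localization.Away (m : A)) (m : A)
  refine ⟨g, (injective_iff_map_eq_zero g).mpr fun z hz ↦ ?_, fun x ↦ ⟨?_, ?_⟩⟩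
  · obtain ⟨k, a, h₁, h₂⟩ := key z
    rw [hz, mul_zero, eq_comm, map_eq_zero_iff _ hA] at h₁
    rw [h₁, map_zero] at h₂
    exact (hum.pow k).mul_right_eq_zero.mp h₂
  · rintro ⟨z, rfl⟩
    obtain ⟨k, a, h, -⟩ := key z
    exact ⟨k, a, h.symm⟩
  · rintro ⟨k, a, ha⟩
    refine ⟨(hum.pow k).unit⁻¹ * algebraMap _ _ a, ?_⟩
    have : g ((hum.pow k).unit⁻¹ : (Localization.Away (m : A))ˣ) * m ^ k = 1 := by
      rw [← map_intCast g, ← map_pow, ← map_mul, IsUnit.val_inv_mul, map_one]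
    rw [map_mul, hg, ha, ← mul_assoc, this, one_mul]

/-- Two domains of finite type over `ℤ` with the same fraction field, algebraic over `ℚ`, become
isomorphic after inverting a nonzero integer. -/
theorem exists_away_int_ringEquiv {A B F : Type} [CommRing A] [IsDomain A] [CommRing B] [IsDomain B]
    [Algebra.FiniteType ℤ A] [Algebra.FiniteType ℤ B] [Field F] [CharZero F]
    [Algebra A F] [IsFractionRing A F] [Algebra B F] [IsFractionRing B F]
    [Algebra.IsAlgebraic ℤ F] :
    ∃ m : ℤ, m ≠ 0 ∧ Nonempty (Localization.Away (m : A) ≃+* Localization.Away (m : B)) := by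
  obtain ⟨m, hm, hBA⟩ := exists_int_pow_smul_mem_range (A := A) (algebraMap B F)
  obtain ⟨n, hn, hAB⟩ := exists_int_pow_smul_mem_range (A := B) (algebraMap A F)
  have hmn : m * n ≠ 0 := mul_ne_zero hm hn
  obtain ⟨g, hg, hgr⟩ := exists_away_ringHom_range (IsFractionRing.injective A F) hmn
  obtain ⟨h, hh, hhr⟩ := exists_away_ringHom_range (IsFractionRing.injective B F) hmn
  have hr : g.range = h.range := by
    ext x
    rw [hgr, hhr]
    constructor
    · rintro ⟨k, a, ha⟩
      obtain ⟨l, hl⟩ := hAB a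
      refine ⟨k + l, ?_⟩
      have : ((m * n : ℤ) : F) ^ (k + l) * x =
          (algebraMap B F (m ^ l : ℤ)) * (n ^ l * algebraMap A F a) := by
        rw [ha]; push_cast; simp; ring
      exact this ▸ mul_mem ⟨_, rfl⟩ hl
    · rintro ⟨k, a, ha⟩
      obtain ⟨l, hl⟩ := hBA a
      refine ⟨k + l, ?_⟩
      have : ((m * n : ℤ) : F) ^ (k + l) * x =
          (algebraMap A F (n ^ l : ℤ)) * (m ^ l * algebraMap B F a) := by
        rw [ha]; push_cast; simp; ring
      exact this ▸ mul_mem ⟨_, rfl⟩ hl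
  let eg := RingEquiv.ofBijective g.rangeRestrict
    ⟨fun a b hab ↦ hg (congrArg Subtype.val hab), g.rangeRestrict_surjective⟩
  let eh := RingEquiv.ofBijective h.rangeRestrict
    ⟨fun a b hab ↦ hh (congrArg Subtype.val hab), h.rangeRestrict_surjective⟩
  exact ⟨m * n, hmn, ⟨eg.trans ((RingEquiv.subringCongr hr).trans eh.symm)⟩⟩

/-! ### Building blocks of dimension at most one -/

theorem exists_charP_residueField_of_intCast_eq_zero {A : CommRingCat.{0}} {m : ℤ} (hm : m ≠ 0)
    (h : (m : A) = 0) (x : Spec A) :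
    ∃ p : ℕ, 0 < p ∧ CharP ((Spec A).residueField x) p := by
  obtain ⟨p, hp⟩ := CharP.exists ((Spec A).residueField x)
  refine ⟨p, Nat.pos_of_ne_zero ?_, hp⟩
  rintro rfl
  have : CharZero ((Spec A).residueField x) := CharP.charP_to_charZero _
  let f : A →+* (Spec A).residueField x :=
    (Spec.preimage ((Spec A).fromSpecResidueField x)).hom
  exact hm (by simpa using congrArg f h)

/-- The generic point of the spectrum of a domain, given by the zero ideal. -/
def zeroPoint (A : CommRingCat.{0}) [IsDomain A] : Spec A := (⊥ : PrimeSpectrum A)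

/-- The residue field at the generic point, as a fraction field of `A`. -/
noncomputable def residueFieldZeroPointEquiv (A : CommRingCat.{0}) [IsDomain A] :
    (Spec A).residueField (zeroPoint A) ≃+* (⊥ : Ideal A).ResidueField :=
  (Scheme.Spec.residueFieldIso A (zeroPoint A)).commRingCatIsoToRingEquiv

theorem charP_of_charP_residueField_zeroPoint (A : CommRingCat.{0}) [IsDomain A] (p : ℕ)
    [CharP ((Spec A).residueField (zeroPoint A)) p] : CharP A p := by
  have := charP_of_injective_ringHom (f := (residueFieldZeroPointEquiv A).toRingHom)
    (RingHom.injective _) p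
  exact (algebraMap A (⊥ : Ideal A).ResidueField).charP (IsFractionRing.injective A _) p

/-- Such a spectrum is a curve over `𝔽_p`, or the spectrum of a finite field if `A` is a field. -/
theorem ClassCZ.of_finiteType_charP (A : CommRingCat.{0}) [IsDomain A] [Algebra.FiniteType ℤ A]
    (p : ℕ) (hp : 0 < p) [CharP A p] (hdim : topologicalKrullDim (Spec A) ≤ 1) :
    ClassCZ (Spec A) := by
  have : Fact p.Prime := ⟨(CharP.char_is_prime_or_zero A p).resolve_right hp.ne'⟩
  let _ : Algebra (ZMod p) A := ZMod.algebra A p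
  have : Algebra.FiniteType (ZMod p) A := .of_restrictScalars_finiteType ℤ _ _
  have hdim' : topologicalKrullDim (Spec A) = ringKrullDim A :=
    PrimeSpectrum.topologicalKrullDim_eq_ringKrullDim A
  by_cases hA : IsField A
  · let _ := hA.toField
    have : Module.Finite (ZMod p) A := finite_of_finite_type_of_isJacobsonRing _ _
    have : Finite A := Module.finite_of_finite (ZMod p)
    exact .finiteField A
  · let f : Spec A ⟶ Spec (.of (ZMod p)) := Spec.map (CommRingCat.ofHom (algebraMap (ZMod p) A))
    refine .curve (ZMod p) f ⟨inferInstance, inferInstance, ?_, inferInstance, ?_⟩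
    · rw [HasRingHomProperty.Spec_iff (P := @LocallyOfFiniteType)]
      exact RingHom.finiteType_algebraMap.mpr inferInstance
    · refine le_antisymm hdim ?_
      rw [hdim']
      by_contra! hlt
      have : Ring.KrullDimLE 0 A := Ring.krullDimLE_iff.mpr
        (ENat.WithBot.lt_add_one_iff.mp (by simpa using hlt))
      exact hA Ring.KrullDimLE.isField_of_isDomain

/-- Schemes of dimension at most one whose points all have positive characteristic. No bound on the
characteristics is assumed; each integral affine open has a single one. -/
theorem ClassCZ.of_charP {X : Scheme.{0}} (hX : IsArithmeticScheme X)
    (h : ∀ x : X, ∃ p : ℕ, 0 < p ∧ CharP (X.residueField x) p)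
    (hdim : topologicalKrullDim X ≤ 1) : ClassCZ X := by
  refine .of_exists_open (fun X ↦ IsArithmeticScheme X ∧
    (∀ x : X, ∃ p : ℕ, 0 < p ∧ CharP (X.residueField x) p) ∧ topologicalKrullDim X ≤ 1)
    ?_ ?_ ?_ X ⟨hX, h, hdim⟩
  · rintro Z X i _ ⟨hX, h, hdim⟩
    refine ⟨hX.comp i, fun x ↦ ?_, i.isEmbedding.isInducing.topologicalKrullDim_le.trans hdim⟩
    obtain ⟨p, hp, _⟩ := h (i x)
    exact ⟨p, hp, charP_of_injective_ringHom (f := (i.residueFieldMap x).hom)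
      (RingHom.injective _) p⟩
  · exact fun X h ↦ ⟨h.1, fun x ↦ .inl (h.2.1 x)⟩
  · rintro X ⟨hX, h, hdim⟩ _ _
    have := hX.isNoetherian
    obtain ⟨A, j, _, _⟩ := exists_isOpenImmersion_Spec_isDomain X
    have : Algebra.FiniteType ℤ A := isArithmeticScheme_Spec_iff.mp (hX.comp j)
    obtain ⟨p, hp, _⟩ := h (j (zeroPoint A))
    have := charP_of_injective_ringHom (f := (j.residueFieldMap (zeroPoint A)).hom)
      (RingHom.injective _) p
    have := charP_of_charP_residueField_zeroPoint A p
    exact ⟨_, j, inferInstance, inferInstance, .of_finiteType_charP A p hp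
      (j.isOpenEmbedding.isInducing.topologicalKrullDim_le.trans hdim)⟩

open NumberField in
theorem hasAdmissibleResidueFields_Spec_ringOfIntegers (F : Type) [Field F]
    (hF : IsAbelianNumberField F) : HasAdmissibleResidueFields (Spec (.of (𝓞 F))) := by
  have : NumberField F := hF.1
  intro x
  by_cases hx : x = zeroPoint (.of (𝓞 F))
  · subst hx
    refine .inr (hF.of_ringEquiv ?_)
    exact (FractionRing.algEquiv (𝓞 F) F).symm.toRingEquiv.trans
      ((FractionRing.algEquiv (𝓞 F) (⊥ : Ideal (𝓞 F)).ResidueField).toRingEquiv.trans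
        (residueFieldZeroPointEquiv (.of (𝓞 F))).symm)
  · have : Finite (𝓞 F ⧸ x.asIdeal) := Ideal.finiteQuotientOfFreeOfNeBot _
      fun h ↦ hx (PrimeSpectrum.ext h)
    have : x.asIdeal.IsPrime := PrimeSpectrum.isPrime x
    have : Finite x.asIdeal.ResidueField := inferInstance
    let e := (Scheme.Spec.residueFieldIso (.of (𝓞 F)) x).commRingCatIsoToRingEquiv
    have : Finite ((Spec (.of (𝓞 F))).residueField x) := Finite.of_equiv _ e.symm.toEquiv
    obtain ⟨p, hp⟩ := CharP.exists ((Spec (.of (𝓞 F))).residueField x)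
    exact .inl ⟨p, Nat.pos_of_ne_zero
      (CharP.char_ne_zero_of_finite ((Spec (.of (𝓞 F))).residueField x) p), hp⟩

open NumberField in
/-- `Spec (𝓞 F)[1/m]` is the complement in `Spec (𝓞 F)` of `Spec (𝓞 F / m)`, whose points all have
positive characteristic. -/
theorem ClassCZ.away_ringOfIntegers (F : Type) [Field F] (hF : IsAbelianNumberField F) {m : ℤ}
    (hm : m ≠ 0) : ClassCZ (Spec (.of (Localization.Away (m : 𝓞 F)))) := by
  have : NumberField F := hF.1
  let X := Spec (.of (𝓞 F))
  have hX : IsArithmeticScheme X := isArithmeticScheme_Spec_iff.mpr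
    (inferInstanceAs (Algebra.FiniteType ℤ (𝓞 F)))
  have := hX.isNoetherian
  have hXr := hasAdmissibleResidueFields_Spec_ringOfIntegers F hF
  have good {V : Scheme.{0}} (f : V ⟶ X) [IsPreimmersion f] [LocallyOfFiniteType f]
      [QuasiCompact f] : HasSmoothQuasiProjectiveFiber V :=
    (hXr.of_isPreimmersion f).hasSmoothQuasiProjectiveFiber (hX.comp f)
  let j : Spec (.of (Localization.Away (m : 𝓞 F))) ⟶ X :=
    Spec.map (CommRingCat.ofHom (algebraMap (𝓞 F) (Localization.Away (m : 𝓞 F))))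
  let I := Ideal.span {(m : 𝓞 F)}
  let i : Spec (.of (𝓞 F ⧸ I)) ⟶ X := Spec.map (CommRingCat.ofHom (Ideal.Quotient.mk I))
  have : IsOpenImmersion j := IsOpenImmersion.of_isLocalization (m : 𝓞 F)
  have : IsClosedImmersion i := IsClosedImmersion.spec_of_surjective _ Ideal.Quotient.mk_surjective
  have hdec : IsClosedOpenDecomposition i j := by
    refine ⟨inferInstance, inferInstance, ?_⟩
    have h₁ : Set.range j = (PrimeSpectrum.zeroLocus {(m : 𝓞 F)})ᶜ :=
      (PrimeSpectrum.localization_away_comap_range _ _).trans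
        (PrimeSpectrum.basicOpen_eq_zeroLocus_compl _)
    have h₂ : Set.range i = PrimeSpectrum.zeroLocus {(m : 𝓞 F)} := by
      refine (range_comap_of_surjective _ _ Ideal.Quotient.mk_surjective).trans ?_
      rw [Ideal.mk_ker, PrimeSpectrum.zeroLocus_span]
    rw [h₁, h₂]
    rfl
  refine .openPart i j hX hdec (good i) (good (𝟙 X)) (good j) ?_ (.ringOfIntegers F hF)
  refine .of_charP (hX.comp i) (exists_charP_residueField_of_intCast_eq_zero hm ?_) ?_
  · change ((m : ℤ) : 𝓞 F ⧸ I) = 0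
    rw [← map_intCast (Ideal.Quotient.mk I), Ideal.Quotient.eq_zero_iff_mem]
    exact Ideal.mem_span_singleton_self _
  · refine i.isEmbedding.isInducing.topologicalKrullDim_le.trans ?_
    refine (PrimeSpectrum.topologicalKrullDim_eq_ringKrullDim (𝓞 F)).trans_le ?_
    exact Ring.krullDimLE_iff.mp (inferInstance : Ring.KrullDimLE 1 (𝓞 F))

theorem ClassCZ.of_hasAdmissibleResidueFields {X : Scheme.{0}} (hX : IsArithmeticScheme X)
    (h : HasAdmissibleResidueFields X) (hdim : topologicalKrullDim X ≤ 1) : ClassCZ X := by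
  refine .of_exists_open (fun X ↦ IsArithmeticScheme X ∧
    HasAdmissibleResidueFields X ∧ topologicalKrullDim X ≤ 1) ?_ ?_ ?_ X ⟨hX, h, hdim⟩
  · rintro Z X i _ ⟨hX, h, hdim⟩
    exact ⟨hX.comp i, h.of_isPreimmersion i,
      i.isEmbedding.isInducing.topologicalKrullDim_le.trans hdim⟩
  · exact fun X h ↦ ⟨h.1, h.2.1⟩
  · rintro X ⟨hX, h, hdim⟩ _ _
    have := hX.isNoetherian
    obtain ⟨A, j, _, _⟩ := exists_isOpenImmersion_Spec_isDomain X
    have : Algebra.FiniteType ℤ A := isArithmeticScheme_Spec_iff.mp (hX.comp j)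
    let κ := (⊥ : Ideal A).ResidueField
    obtain ⟨p, hp, _⟩ | hF := h.of_isPreimmersion j (zeroPoint A)
    · have := charP_of_charP_residueField_zeroPoint A p
      exact ⟨_, j, inferInstance, inferInstance, .of_finiteType_charP A p hp
        (j.isOpenEmbedding.isInducing.topologicalKrullDim_le.trans hdim)⟩
    · replace hF : IsAbelianNumberField κ := hF.of_ringEquiv (residueFieldZeroPointEquiv A)
      have : NumberField κ := hF.1
      have := hF.isAlgebraic_int
      obtain ⟨m, hm, ⟨e⟩⟩ :=
        exists_away_int_ringEquiv (A := A) (B := NumberField.RingOfIntegers κ) (F := κ)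
      have : CharZero A :=
        ((algebraMap A κ).charZero_iff (IsFractionRing.injective A κ)).mpr inferInstance
      let k : Spec (.of (Localization.Away (m : A))) ⟶ Spec A :=
        Spec.map (CommRingCat.ofHom (algebraMap A (Localization.Away (m : A))))
      have : IsOpenImmersion k := IsOpenImmersion.of_isLocalization (m : A)
      have : Nontrivial (Localization.Away (m : A)) :=
        (IsLocalization.injective _ (powers_le_nonZeroDivisors_of_noZeroDivisors
          (Int.cast_ne_zero.mpr hm))).nontrivial (α := A)
      exact ⟨_, k ≫ j, inferInstance, inferInstance,
        .of_iso (Scheme.Spec.mapIso e.toCommRingCatIso.op) (.away_ringOfIntegers κ hF hm)⟩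

end ArithScheme

theorem mainTheorem7 (B : Scheme.{0}) (hB : ArithScheme.IsArithmeticScheme B)
    (hdim : topologicalKrullDim B = 1)
    (hη : ∀ η ∈ genericPoints B,
      (∃ p : ℕ, 0 < p ∧ CharP (B.residueField η) p) ∨
        (CharP (B.residueField η) 0 ∧ ArithScheme.IsAbelianNumberField (B.residueField η))) :
    ArithScheme.ClassCZ B :=
  .of_hasAdmissibleResidueFields hB
    (.of_genericPoints fun η h ↦ (hη η h).imp id And.right) hdim.le
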